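/- Let $n\ge 1$ and let $S_n$ be the set of permutations $\sigma=\sigma_1\sigma_2\cdots\sigma_n$ of $[n]=\{1,\dots,n\}$, written $\sigma_i=\sigma(i)$. Let $\mathrm{SE}_n$ be the set of integer sequences $(a_1,\dots,a_n)$ with $1\le a_i\le i$ for all $i\in[n]$. The Lehmer code of $\sigma\in S_n$ is the sequence $\mathrm{Leh}(\sigma)=(a_1,\dots,a_n)\in \mathrm{SE}_n$ with $a_i=|\{j : 1\le j\le i,\ \sigma_j\le\sigma_i\}|$, and the A-code of $\sigma$ is $\text{A-code}(\sigma)=\mathrm{Leh}(\sigma^{-1})$. For $i\in[n]$ let $k(i)$ be the smallest integer $k\ge 1$ such that $\sigma^{-k}(i)\le i$; the B-code of $\sigma$ is the sequence $\text{B-code}(\sigma)=(b_1,\dots,b_n)\in \mathrm{SE}_n$ with $b_i=\sigma^{-k(i)}(i)$. The map $\text{B-code}\colon S_n\to \mathrm{SE}_n$ is a bijection; let $\gamma=(\text{B-code})^{-1}\circ\text{A-code}\colon S_n\to S_n$. Proposition. The map $\gamma$ preserves the statistic $r(\sigma)=\max_{1\le i\le n}(\sigma_i-i)$; that is, for every $\sigma\in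 S_n$, $$r(\sigma)=r(\gamma(\sigma)).$$ -/

import Mathlib

/-- Sequences `(a_1, …, a_n)` of integers with `1 ≤ a_i ≤ i`. The index `i ∈ {1, …, n}` is
represented by the element `i - 1` of `Fin n`; the entries are the actual integers. -/
def SESeq (n : ℕ) : Type :=
  {a : Fin n → ℕ // ∀ i : Fin n, 1 ≤ a i ∧ a i ≤ (i : ℕ) + 1}

/-- The Lehmer code of `σ`: `a_i = #{j : 1 ≤ j ≤ i, σ_j ≤ σ_i}`. -/
def lehmerCode {n : ℕ} (σ : Equiv.Perm (Fin n)) : SESeq n :=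
  ⟨fun i => (Finset.univ.filter (fun j : Fin n => j ≤ i ∧ σ j ≤ σ i)).card, fun i => by
    constructor
    · exact Finset.card_pos.mpr ⟨i, by simp⟩
    · rw [← Fin.card_Iic i]
      apply Finset.card_le_card
      intro j hj
      simp only [Finset.mem_filter, Finset.mem_univ, true_and] at hj
      exact Finset.mem_Iic.mpr hj.1⟩

/-- The A-code of `σ` is the Lehmer code of `σ⁻¹`. -/
def aCode {n : ℕ} (σ : Equiv.Perm (Fin n)) : SESeq n := lehmerCode σ⁻¹

theorem exists_return {n : ℕ} (σ : Equiv.Perm (Fin n)) (i : Fin n) :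
    ∃ k : ℕ, 1 ≤ k ∧ (σ⁻¹ ^ k) i ≤ i :=
  ⟨orderOf σ⁻¹, orderOf_pos _, by simp [pow_orderOf_eq_one]⟩

/-- `k(i)`: the smallest integer `k ≥ 1` such that `σ^{-k}(i) ≤ i`. -/
def returnTime {n : ℕ} (σ : Equiv.Perm (Fin n)) (i : Fin n) : ℕ :=
  Nat.find (exists_return σ i)

/-- The B-code of `σ`: `b_i = σ^{-k(i)}(i)` (the `+ 1` translates an element of `Fin n` into the
letter of `{1, …, n}` that it represents). -/
def bCode {n : ℕ} (σ : Equiv.Perm (Fin n)) : SESeq n :=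
  ⟨fun i => (((σ⁻¹ ^ returnTime σ i) i : Fin n) : ℕ) + 1, fun i =>
    ⟨Nat.le_add_left _ _, Nat.add_le_add_right (Nat.find_spec (exists_return σ i)).2 1⟩⟩

/-- `y` is the first point of the `g`-orbit `g x, g² x, …` that lies below `m`
(an auxiliary notion, used only to see that the B-code is a bijection). -/
def FirstReturn {n : ℕ} (g : Equiv.Perm (Fin n)) (m : ℕ) (x y : Fin n) : Prop :=
  ∃ k : ℕ, 1 ≤ k ∧ (g ^ k) x = y ∧ (y : ℕ) < m ∧
    ∀ j : ℕ, 1 ≤ j → j < k → m ≤ (((g ^ j) x : Fin n) : ℕ)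

theorem FirstReturn.unique {n : ℕ} {g : Equiv.Perm (Fin n)} {m : ℕ} {x y z : Fin n}
    (h : FirstReturn g m x y) (h' : FirstReturn g m x z) : y = z := by
  obtain ⟨k, hk, rfl, hy, hj⟩ := h
  obtain ⟨l, hl, rfl, hz, hi⟩ := h'
  rcases lt_trichotomy k l with hkl | rfl | hkl
  · have := hi k hk hkl
    omega
  · rfl
  · have := hj l hl hkl
    omega

theorem FirstReturn.inj_aux {n : ℕ} {g : Equiv.Perm (Fin n)} {m k l : ℕ} {x x' : Fin n}
    (hkl : k ≤ l) (hk : 1 ≤ k) (hx : (x : ℕ) < m) (he : (g ^ k) x = (g ^ l) x')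
    (hi : ∀ j : ℕ, 1 ≤ j → j < l → m ≤ (((g ^ j) x' : Fin n) : ℕ)) : x = x' := by
  obtain ⟨d, rfl⟩ := Nat.exists_eq_add_of_le hkl
  rw [pow_add, Equiv.Perm.mul_apply] at he
  have hxd : x = (g ^ d) x' := (g ^ k).injective he
  rcases Nat.eq_zero_or_pos d with rfl | hd
  · simpa using hxd
  · have := hi d hd (by omega)
    rw [← hxd] at this
    omega

theorem FirstReturn.inj {n : ℕ} {g : Equiv.Perm (Fin n)} {m : ℕ} {x x' y : Fin n}
    (hx : (x : ℕ) < m) (hx' : (x' : ℕ) < m)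
    (h : FirstReturn g m x y) (h' : FirstReturn g m x' y) : x = x' := by
  obtain ⟨k, hk, he, hy, hj⟩ := h
  obtain ⟨l, hl, he', -, hi⟩ := h'
  rcases le_total k l with hkl | hkl
  · exact FirstReturn.inj_aux hkl hk hx (he.trans he'.symm) hi
  · exact (FirstReturn.inj_aux hkl hl hx' (he'.trans he.symm) hj).symm

theorem FirstReturn.exists {n : ℕ} (g : Equiv.Perm (Fin n)) {m : ℕ} {x : Fin n}
    (hx : (x : ℕ) < m) : ∃ y, FirstReturn g m x y := by
  have hex : ∃ k : ℕ, 1 ≤ k ∧ (((g ^ k) x : Fin n) : ℕ) < m :=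
    ⟨orderOf g, orderOf_pos _, by simpa [pow_orderOf_eq_one] using hx⟩
  refine ⟨_, Nat.find hex, (Nat.find_spec hex).1, rfl, (Nat.find_spec hex).2, ?_⟩
  intro j hj hjk
  have := Nat.find_min hex hjk
  omega

theorem FirstReturn.of_lt {n : ℕ} {g : Equiv.Perm (Fin n)} {m : ℕ} {x y : Fin n}
    (h : FirstReturn g (m + 1) x y) (hy : (y : ℕ) < m) : FirstReturn g m x y := by
  obtain ⟨k, hk, he, -, hj⟩ := h
  exact ⟨k, hk, he, hy, fun j h1 h2 => (Nat.le_succ m).trans (hj j h1 h2)⟩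

theorem FirstReturn.comp {n : ℕ} {g : Equiv.Perm (Fin n)} {m : ℕ} {x y z : Fin n}
    (hy : (y : ℕ) = m) (h : FirstReturn g (m + 1) x y) (h' : FirstReturn g (m + 1) y z)
    (hz : (z : ℕ) < m) : FirstReturn g m x z := by
  obtain ⟨k, hk, he, -, hj⟩ := h
  obtain ⟨l, hl, he', -, hi⟩ := h'
  refine ⟨l + k, by omega, by rw [pow_add, Equiv.Perm.mul_apply, he, he'], hz, ?_⟩
  intro j h1 h2
  rcases lt_trichotomy j k with hjk | rfl | hjk
  · exact (Nat.le_succ m).trans (hj j h1 hjk)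
  · rw [he, hy]
  · obtain ⟨d, rfl⟩ := Nat.exists_eq_add_of_lt hjk
    have := hi (d + 1) (by omega) (by omega)
    rw [show k + d + 1 = (d + 1) + k by omega, pow_add, Equiv.Perm.mul_apply, he]
    omega

theorem FirstReturn.step {n : ℕ} {g h : Equiv.Perm (Fin n)} {p b : Fin n}
    (hg : FirstReturn g (p + 1) p b) (hh : FirstReturn h (p + 1) p b)
    (ih : ∀ x y : Fin n, x < p → FirstReturn g p x y → FirstReturn h p x y)
    {x y : Fin n} (hx : x ≤ p) (hxy : FirstReturn g (p + 1) x y) :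
    FirstReturn h (p + 1) x y := by
  rcases hx.eq_or_lt with rfl | hx
  · rwa [hxy.unique hg]
  have hx1 : (x : ℕ) < p + 1 := by have : (x : ℕ) < p := hx; omega
  have hp1 : (p : ℕ) < p + 1 := by omega
  have key : ∀ {f : Equiv.Perm (Fin n)}, FirstReturn f (p + 1) p b →
      FirstReturn f (p + 1) x p → FirstReturn f p x b := by
    intro f hf hxp
    have hb : b ≠ p := fun hb => hx.ne (FirstReturn.inj hx1 hp1 hxp (hb ▸ hf))
    refine FirstReturn.comp rfl hxp hf ?_
    have h1 : (b : ℕ) < p + 1 := by obtain ⟨_, _, _, h1, _⟩ := hf; exact h1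
    have h2 : (b : ℕ) ≠ p := fun h => hb (Fin.ext h)
    omega
  have lt_or : ∀ {f : Equiv.Perm (Fin n)} {z : Fin n}, FirstReturn f (p + 1) x z →
      (z : ℕ) < p ∨ z = p := by
    intro f z hf
    obtain ⟨_, _, _, h1, _⟩ := hf
    rcases Nat.lt_succ_iff_lt_or_eq.mp h1 with h | h
    · exact Or.inl h
    · exact Or.inr (Fin.ext h)
  obtain ⟨y', hxy'⟩ := FirstReturn.exists h hx1
  suffices hy : y = y' by rwa [hy]
  rcases lt_or hxy with hy | rfl
  · have h1 := ih x y hx (hxy.of_lt hy)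
    rcases lt_or hxy' with hy' | rfl
    · exact h1.unique (hxy'.of_lt hy')
    · have hyb := h1.unique (key hh hxy')
      exact absurd (FirstReturn.inj hx1 hp1 hxy (hyb ▸ hg)) hx.ne
  · have h1 := ih x b hx (key hg hxy)
    rcases lt_or hxy' with hy' | rfl
    · have hyb := (hxy'.of_lt hy').unique h1
      exact absurd (FirstReturn.inj hx1 hp1 hxy' (hyb ▸ hh)) hx.ne
    · rfl

theorem firstReturn_bCode {n : ℕ} (σ : Equiv.Perm (Fin n)) (i : Fin n) :
    FirstReturn σ⁻¹ (i + 1) i ((σ⁻¹ ^ returnTime σ i) i) := by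
  refine ⟨returnTime σ i, (Nat.find_spec (exists_return σ i)).1, rfl,
    Nat.lt_succ_of_le (Nat.find_spec (exists_return σ i)).2, ?_⟩
  intro j hj hjk
  have h := Nat.find_min (exists_return σ i) hjk
  have h' : i < (σ⁻¹ ^ j) i := not_le.mp fun hle => h ⟨hj, hle⟩
  exact h'

theorem bCode_injective (n : ℕ) :
    Function.Injective (bCode : Equiv.Perm (Fin n) → SESeq n) := by
  intro σ τ hst
  have hb : ∀ i, (σ⁻¹ ^ returnTime σ i) i = (τ⁻¹ ^ returnTime τ i) i := by
    intro i
    have h := congrFun (congrArg Subtype.val hst) i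
    exact Fin.ext (Nat.succ_injective h)
  have main : ∀ m : ℕ, m ≤ n → ∀ x y : Fin n, (x : ℕ) < m →
      FirstReturn σ⁻¹ m x y → FirstReturn τ⁻¹ m x y := by
    intro m
    induction m with
    | zero => intro _ x y hx; omega
    | succ m ih =>
      intro hm x y hx hxy
      have h1 := firstReturn_bCode σ ⟨m, hm⟩
      have h2 := firstReturn_bCode τ ⟨m, hm⟩
      rw [← hb] at h2
      exact FirstReturn.step h1 h2 (fun x y hx h => ih (by omega) x y hx h)
        (Nat.lt_succ_iff.mp hx) hxy
  apply inv_injective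
  ext x
  have h1 : FirstReturn σ⁻¹ n x (σ⁻¹ x) := ⟨1, le_rfl, by simp, (σ⁻¹ x).2, by omega⟩
  have h2 : FirstReturn τ⁻¹ n x (τ⁻¹ x) := ⟨1, le_rfl, by simp, (τ⁻¹ x).2, by omega⟩
  rw [(main n le_rfl x _ x.2 h1).unique h2]

/-- The sequences with `1 ≤ a_i ≤ i` are the elements of `∏ i, {1, …, i}`. -/
def SESeq.equivPi (n : ℕ) : SESeq n ≃ ((i : Fin n) → Fin ((i : ℕ) + 1)) where
  toFun a i := ⟨a.1 i - 1, by have := a.2 i; omega⟩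
  invFun c := ⟨fun i => (c i : ℕ) + 1, fun i =>
    ⟨Nat.le_add_left _ _, Nat.succ_le_of_lt (c i).2⟩⟩
  left_inv a := by
    apply Subtype.ext
    funext i
    have := a.2 i
    show a.1 i - 1 + 1 = a.1 i
    omega
  right_inv c := by
    funext i
    apply Fin.ext
    show (c i : ℕ) + 1 - 1 = c i
    omega

theorem bCode_bijective (n : ℕ) :
    Function.Bijective (bCode : Equiv.Perm (Fin n) → SESeq n) := by
  let _ : Fintype (SESeq n) := Fintype.ofEquiv _ (SESeq.equivPi n).symm
  refine (Fintype.bijective_iff_injective_and_card _).mpr ⟨bCode_injective n, ?_⟩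
  rw [Fintype.card_congr (SESeq.equivPi n), Fintype.card_perm, Fintype.card_fin,
    Fintype.card_pi]
  simp only [Fintype.card_fin]
  rw [Fin.prod_univ_eq_prod_range (fun i => i + 1) n, Finset.prod_range_add_one_eq_factorial]

/-- The B-code as a bijection between permutations and sequences with `1 ≤ a_i ≤ i`. -/
noncomputable def bCodeEquiv (n : ℕ) : Equiv.Perm (Fin n) ≃ SESeq n :=
  Equiv.ofBijective bCode (bCode_bijective n)

/-- The map `γ = (B-code)⁻¹ ∘ A-code` on permutations. -/
noncomputable def gammaMap {n : ℕ} (σ : Equiv.Perm (Fin n)) : Equiv.Perm (Fin n) :=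
  (bCodeEquiv n).symm (aCode σ)

/-- The statistic `r(σ) = max_i (σ_i - i)`. Representing both letters and places by elements of
`Fin n` shifts them equally, so the difference is the usual one. -/
def rStat {n : ℕ} [NeZero n] (σ : Equiv.Perm (Fin n)) : ℤ :=
  Finset.univ.sup' Finset.univ_nonempty
    (fun i : Fin n => ((σ i : ℕ) : ℤ) - ((i : ℕ) : ℤ))

/-! Both codes determine `r` by the same formula: `r(σ)` is the maximum of `i - c_i`, whether `c` is
the A-code or the B-code of `σ`. Since the B-code of `γ(σ)` is the A-code of `σ`, the claim follows.
Write `r(σ)` as the maximum of `j - σ⁻¹(j)`. For the A-code, `a_j ≤ σ⁻¹(j)` gives one inequality,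
and equality holds at any index maximising `i - a_i` (`exists_lehmerCode_le`, `lehmerCode_eq`). For
the B-code, `b_i = σ⁻¹(x)` with `x ≥ i` bounds each `i - b_i` by `r(σ)`, and `b_j = σ⁻¹(j)` where
`r(σ)` is attained. -/

/-- The maximum of `i - a_i` over a sequence with `1 ≤ a_i ≤ i`. -/
def SESeq.maxDefect {n : ℕ} [NeZero n] (a : SESeq n) : ℤ :=
  Finset.univ.sup' Finset.univ_nonempty (fun i : Fin n => ((i : ℕ) : ℤ) + 1 - (a.1 i : ℤ))

theorem SESeq.le_maxDefect {n : ℕ} [NeZero n] (a : SESeq n) (i : Fin n) :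
    ((i : ℕ) : ℤ) + 1 - (a.1 i : ℤ) ≤ a.maxDefect :=
  Finset.le_sup' (fun i : Fin n => ((i : ℕ) : ℤ) + 1 - (a.1 i : ℤ)) (Finset.mem_univ i)

theorem SESeq.exists_eq_maxDefect {n : ℕ} [NeZero n] (a : SESeq n) :
    ∃ i : Fin n, a.maxDefect = ((i : ℕ) : ℤ) + 1 - (a.1 i : ℤ) := by
  obtain ⟨i, -, hi⟩ := Finset.exists_mem_eq_sup' Finset.univ_nonempty
    (fun i : Fin n => ((i : ℕ) : ℤ) + 1 - (a.1 i : ℤ))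
  exact ⟨i, hi⟩

theorem sub_le_rStat {n : ℕ} [NeZero n] (σ : Equiv.Perm (Fin n)) (i : Fin n) :
    ((σ i : ℕ) : ℤ) - ((i : ℕ) : ℤ) ≤ rStat σ :=
  Finset.le_sup' (fun i : Fin n => ((σ i : ℕ) : ℤ) - ((i : ℕ) : ℤ)) (Finset.mem_univ i)

theorem sub_inv_le_rStat {n : ℕ} [NeZero n] (σ : Equiv.Perm (Fin n)) (j : Fin n) :
    ((j : ℕ) : ℤ) - ((σ⁻¹ j : ℕ) : ℤ) ≤ rStat σ := by
  simpa using sub_le_rStat σ (σ⁻¹ j)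

theorem exists_rStat_eq_sub_inv {n : ℕ} [NeZero n] (σ : Equiv.Perm (Fin n)) :
    ∃ j : Fin n, rStat σ = ((j : ℕ) : ℤ) - ((σ⁻¹ j : ℕ) : ℤ) := by
  obtain ⟨i, -, hi⟩ := Finset.exists_mem_eq_sup' Finset.univ_nonempty
    (fun i : Fin n => ((σ i : ℕ) : ℤ) - ((i : ℕ) : ℤ))
  exact ⟨σ i, by simpa [rStat] using hi⟩

theorem rStat_nonneg {n : ℕ} [NeZero n] (σ : Equiv.Perm (Fin n)) : 0 ≤ rStat σ := by
  have h := sub_le_rStat σ 0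
  simp only [Fin.coe_ofNat_eq_mod, Nat.zero_mod] at h
  omega

theorem card_filter_apply_le {n : ℕ} (τ : Equiv.Perm (Fin n)) (i : Fin n) :
    (Finset.univ.filter (fun j : Fin n => τ j ≤ τ i)).card = (τ i : ℕ) + 1 := by
  rw [← Fin.card_Iic (τ i), ← Finset.card_map τ.toEmbedding]
  congr 1
  ext x
  simp only [Finset.mem_map_equiv, Finset.mem_filter, Finset.mem_univ, true_and,
    Equiv.apply_symm_apply, Finset.mem_Iic]

theorem lehmerCode_le {n : ℕ} (τ : Equiv.Perm (Fin n)) (i : Fin n) :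
    (lehmerCode τ).1 i ≤ (τ i : ℕ) + 1 := by
  rw [← card_filter_apply_le τ i]
  show (Finset.univ.filter (fun j : Fin n => j ≤ i ∧ τ j ≤ τ i)).card ≤ _
  exact Finset.card_le_card (Finset.monotone_filter_right _ fun j _ hj => hj.2)

/-- Under `h` the constraint `j ≤ i` in the code is automatic, so every value up to `τ i` is
counted. -/
theorem lehmerCode_eq {n : ℕ} {τ : Equiv.Perm (Fin n)} {i : Fin n}
    (h : ∀ j, τ j ≤ τ i → j ≤ i) : (lehmerCode τ).1 i = (τ i : ℕ) + 1 := by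
  rw [← card_filter_apply_le τ i]
  show (Finset.univ.filter (fun j : Fin n => j ≤ i ∧ τ j ≤ τ i)).card = _
  refine congrArg Finset.card (Finset.filter_congr fun j _ => ?_)
  exact ⟨fun hj => hj.2, fun hj => ⟨h j hj, hj⟩⟩

/-- If a larger place carries a smaller value, then some larger place has a Lehmer code entry
that is no larger. -/
theorem exists_lehmerCode_le {n : ℕ} {τ : Equiv.Perm (Fin n)} {i : Fin n}
    (h : ∃ j, τ j ≤ τ i ∧ i < j) :
    ∃ k, i < k ∧ (lehmerCode τ).1 k ≤ (lehmerCode τ).1 i := by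
  obtain ⟨j, hji, hij⟩ := h
  -- Take `k` to carry the smallest value among the places beyond `i`. Apart from `k` itself,
  -- everything counted at `k` then lies at or before `i`.
  obtain ⟨k, hk, hmin⟩ := Finset.exists_min_image
    (Finset.univ.filter (fun j : Fin n => i < j)) τ ⟨j, by simpa using hij⟩
  simp only [Finset.mem_filter, Finset.mem_univ, true_and] at hk hmin
  have hki : τ k < τ i :=
    lt_of_le_of_ne ((hmin j hij).trans hji) (τ.injective.ne hk.ne')
  refine ⟨k, hk, ?_⟩
  have hsub : (Finset.univ.filter (fun l : Fin n => l ≤ k ∧ τ l ≤ τ k)).erase k ⊆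
      (Finset.univ.filter (fun l : Fin n => l ≤ i ∧ τ l ≤ τ i)).erase i := by
    intro l hl
    simp only [Finset.mem_erase, Finset.mem_filter, Finset.mem_univ, true_and] at hl ⊢
    obtain ⟨hlk, -, hle⟩ := hl
    refine ⟨?_, ?_, hle.trans hki.le⟩
    · rintro rfl
      exact absurd hki (not_lt.mpr hle)
    · by_contra hil
      exact hlk (τ.injective (le_antisymm hle (hmin l (not_le.mp hil))))
  have hcard := Finset.card_le_card hsub
  rw [Finset.card_erase_of_mem (by simp), Finset.card_erase_of_mem (by simp)] at hcard
  have h1 := ((lehmerCode τ).2 i).1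
  have h2 := ((lehmerCode τ).2 k).1
  simp only [lehmerCode] at h1 h2 ⊢
  omega

theorem rStat_eq_maxDefect_aCode {n : ℕ} [NeZero n] (σ : Equiv.Perm (Fin n)) :
    rStat σ = (aCode σ).maxDefect := by
  apply le_antisymm
  · obtain ⟨j, hj⟩ := exists_rStat_eq_sub_inv σ
    have h1 := (aCode σ).le_maxDefect j
    have h2 : (aCode σ).1 j ≤ (σ⁻¹ j : ℕ) + 1 := lehmerCode_le σ⁻¹ j
    omega
  · obtain ⟨i, hi⟩ := (aCode σ).exists_eq_maxDefect
    -- Otherwise some `k > i` has `a_k ≤ a_i`, so `k - a_k > i - a_i`, against maximality.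
    have hrec : ∀ j, σ⁻¹ j ≤ σ⁻¹ i → j ≤ i := by
      by_contra! hcon
      obtain ⟨k, hik, hk⟩ := exists_lehmerCode_le hcon
      have h1 := (aCode σ).le_maxDefect k
      have h2 : (aCode σ).1 k ≤ (aCode σ).1 i := hk
      have h3 : (i : ℕ) < k := hik
      omega
    have h1 : (aCode σ).1 i = (σ⁻¹ i : ℕ) + 1 := lehmerCode_eq hrec
    have h2 := sub_inv_le_rStat σ i
    omega

theorem bCode_eq_of_inv_le {n : ℕ} {σ : Equiv.Perm (Fin n)} {i : Fin n} (h : σ⁻¹ i ≤ i) :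
    (bCode σ).1 i = (σ⁻¹ i : ℕ) + 1 := by
  have hret : FirstReturn σ⁻¹ (i + 1) i (σ⁻¹ i) :=
    ⟨1, le_rfl, by simp, Nat.lt_succ_of_le h, by omega⟩
  have heq := (firstReturn_bCode σ i).unique hret
  exact congrArg (fun x : Fin n => (x : ℕ) + 1) heq

/-- A B-code entry is the image under `σ⁻¹` of a letter that is at least its index. -/
theorem exists_bCode_eq {n : ℕ} (σ : Equiv.Perm (Fin n)) (i : Fin n) :
    ∃ x, i ≤ x ∧ (bCode σ).1 i = (σ⁻¹ x : ℕ) + 1 := by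
  obtain ⟨k, hk, he, -, hj⟩ := firstReturn_bCode σ i
  obtain ⟨l, rfl⟩ := Nat.exists_eq_add_of_le' hk
  -- The last orbit point before the return: it is `i` itself if `l = 0`, and otherwise lies above
  -- `i`.
  refine ⟨(σ⁻¹ ^ l) i, ?_, ?_⟩
  · rcases Nat.eq_zero_or_pos l with rfl | hl
    · simp
    · exact (Nat.le_succ _).trans (hj l hl (Nat.lt_succ_self l))
  · rw [pow_succ', Equiv.Perm.mul_apply] at he
    exact congrArg (fun x : Fin n => (x : ℕ) + 1) he.symm

theorem rStat_eq_maxDefect_bCode {n : ℕ} [NeZero n] (σ : Equiv.Perm (Fin n)) :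
    rStat σ = (bCode σ).maxDefect := by
  apply le_antisymm
  · obtain ⟨j, hj⟩ := exists_rStat_eq_sub_inv σ
    -- Nonnegativity forces `σ⁻¹ j ≤ j`, so the orbit of `j` returns in one step.
    have h0 := rStat_nonneg σ
    have hle : σ⁻¹ j ≤ j := by
      rw [Fin.le_def]
      omega
    have h1 := bCode_eq_of_inv_le hle
    have h2 := (bCode σ).le_maxDefect j
    omega
  · obtain ⟨i, hi⟩ := (bCode σ).exists_eq_maxDefect
    obtain ⟨x, hix, hx⟩ := exists_bCode_eq σ i
    have h1 := sub_inv_le_rStat σ x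
    have h2 : (i : ℕ) ≤ x := hix
    omega

theorem bCode_gammaMap {n : ℕ} (σ : Equiv.Perm (Fin n)) : bCode (gammaMap σ) = aCode σ :=
  (bCodeEquiv n).apply_symm_apply (aCode σ)

theorem mainTheorem6 (n : ℕ) [NeZero n] (σ : Equiv.Perm (Fin n)) :
    rStat σ = rStat (gammaMap σ) := by
  rw [rStat_eq_maxDefect_aCode, rStat_eq_maxDefect_bCode, bCode_gammaMap]
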